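/- A \emph{disjoint tree-grading} on a path-connected, locally path-connected, metrizable space $X$ is a (possibly empty) collection $\mathscr{P}$ of non-empty closed subsets of $X$, called \emph{pieces}, such that (1) $\bigcup\mathscr{P}$ is closed in $X$; (2) the elements of $\mathscr{P}$ are exactly the path components of $\bigcup\mathscr{P}$; (3) every simple closed curve in $X$ (subspace homeomorphic to the circle) is contained in one piece. The pair $(X,\mathscr{P})$ is then called a \emph{disjointly tree-graded space}. A continuous map $f:X\to Y$ between disjointly tree-graded spaces $(X,\mathscr{P})$ and $(Y,\mathscr{Q})$ is \emph{grade-preserving} if $f(\bigcup\mathscr{P})\subseteq\bigcup\mathscr{Q}$. For a space $Z$, $\mathbf{lpc}(Z)$ denotes the locally path-connected coreflection of $Z$: the same set with the topology generated by the path components of the open subsets of $Z$. \textbf{Theorem.} For each $n\in\mathbb{N}$ let $(X_n,\mathscr{P}_n)$ be a disjointly tree-graded space and let $f_{n+1,n}:(X_{n+1},\mathscr{P}_{n+1})\to(X_n,\mathscr{P}_n)$ be a grade-preserving map. Call a sequence $\{P_n\}_{n\in\mathbb{N}}$ of pieces $P_n\in\mathscr{P}_n$ \emph{coherent} if $f_{n+1,n}(P_{n+1})\subseteq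 P_n$ for all $n$. Suppose that for every coherent sequence of pieces $\{P_n\}$, $f_{n+1,n}$ maps $P_{n+1}$ homeomorphically onto $P_n$ for all but finitely many $n$. Let $X_{lim}$ be the path component of a given point $(x_n)_{n\in\mathbb{N}}$ in $\varprojlim_n(X_n,f_{n+1,n})$, let $X_\infty=\mathbf{lpc}(X_{lim})$, and let $\mathscr{P}_\infty$ be the collection of all non-empty sets of the form $X_{lim}\cap\prod_{n}P_n$ with $\{P_n\}$ a coherent sequence of pieces. Then: \begin{enumerate} \item $X_\infty$ is path-connected, locally path-connected and metrizable, and $\mathscr{P}_\infty$ is a disjoint tree-grading on $X_\infty$; \item for every $n$, the projection $f_n:(X_\infty,\mathscr{P}_\infty)\to(X_n,\mathscr{P}_n)$ is grade-preserving; \item for each $P\in\mathscr{P}_\infty$ (with the subspace topology from $X_\infty$), $f_n$ maps $P$ homeomorphically onto a piece of $X_n$ for all but finitely many $n$. \end{enumerate} -/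

import Mathlib

open Set Filter Topology

/-- A simple closed curve in `X`: a subspace homeomorphic to the circle. -/
def IsSimpleClosedCurve {X : Type*} [TopologicalSpace X] (C : Set X) : Prop :=
  Nonempty (C ≃ₜ Circle)

/-- `𝒢` is a disjoint tree-grading on the space `X`, i.e. `(X, 𝒢)` is a disjointly tree-graded
space.  The elements of `𝒢` are the pieces. -/
structure IsDisjointTreeGrading {X : Type*} [TopologicalSpace X] (𝒢 : Set (Set X)) : Prop where
  pathConnected : PathConnectedSpace X
  locallyPathConnected : LocallyPathConnectedSpace X
  metrizable : TopologicalSpace.MetrizableSpace X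
  nonempty_of_mem : ∀ P ∈ 𝒢, P.Nonempty
  isClosed_of_mem : ∀ P ∈ 𝒢, IsClosed P
  isClosed_sUnion : IsClosed (⋃₀ 𝒢)
  /-- The pieces are exactly the path components of the union of the pieces. -/
  eq_pathComponents : 𝒢 = {C | ∃ x ∈ ⋃₀ 𝒢, C = pathComponentIn (⋃₀ 𝒢) x}
  /-- Every simple closed curve lies in one piece. -/
  simpleClosedCurve : ∀ C : Set X, IsSimpleClosedCurve C → ∃ P ∈ 𝒢, C ⊆ P

/-- A grade-preserving map: a continuous map sending the piece-portion (the union of the pieces)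
into the piece-portion. -/
def IsGradePreserving {X Y : Type*} [TopologicalSpace X] [TopologicalSpace Y]
    (𝒢 : Set (Set X)) (𝒬 : Set (Set Y)) (f : X → Y) : Prop :=
  Continuous f ∧ f '' (⋃₀ 𝒢) ⊆ ⋃₀ 𝒬

/-- `f` maps the subspace `P` homeomorphically onto the subspace `Q`. -/
def MapsHomeomorphicallyOnto {X Y : Type*} [TopologicalSpace X] [TopologicalSpace Y]
    (f : X → Y) (P : Set X) (Q : Set Y) : Prop :=
  IsEmbedding (fun x : P => f x) ∧ f '' P = Q

/-- A coherent sequence of pieces of an inverse sequence of spaces with given families of pieces. -/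
def IsCoherent {X : ℕ → Type*} (𝒢 : ∀ n, Set (Set (X n))) (f : ∀ n, X (n + 1) → X n)
    (P : ∀ n, Set (X n)) : Prop :=
  (∀ n, P n ∈ 𝒢 n) ∧ ∀ n, f n '' P (n + 1) ⊆ P n

/-- The inverse limit of a sequence of spaces, with the subspace topology from the product. -/
abbrev InverseLimit {X : ℕ → Type*} (f : ∀ n, X (n + 1) → X n) : Type _ :=
  {x : ∀ n, X n // ∀ n, f n (x (n + 1)) = x n}

/-- The locally path-connected coreflection of `X`: a copy of the set `X`, with the topology
generated by the path components of the open subsets of `X`.  The field `toBase` is the identity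
function to `X`. -/
structure Lpc (X : Type*) where
  toBase : X

instance Lpc.instTopologicalSpace (X : Type*) [TopologicalSpace X] : TopologicalSpace (Lpc X) :=
  TopologicalSpace.generateFrom
    {W : Set (Lpc X) | ∃ U : Set X, IsOpen U ∧ ∃ x ∈ U, W = Lpc.toBase ⁻¹' pathComponentIn U x}

/-- The locally path-connected coreflection of the path component of `x₀` in the inverse limit. -/
abbrev LimitSpace {X : ℕ → Type*} [∀ n, TopologicalSpace (X n)] (f : ∀ n, X (n + 1) → X n)
    (x₀ : InverseLimit f) : Type _ :=
  Lpc (pathComponent x₀)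

/-- The projection of the limit space to the `n`-th term of the sequence. -/
def LimitSpace.proj {X : ℕ → Type*} [∀ n, TopologicalSpace (X n)] (f : ∀ n, X (n + 1) → X n)
    (x₀ : InverseLimit f) (n : ℕ) (x : LimitSpace f x₀) : X n :=
  x.toBase.1.1 n

/-- The non-empty sets that are the intersection of the limit space with the product of
a coherent sequence of pieces. -/
def LimitSpace.pieces {X : ℕ → Type*} [∀ n, TopologicalSpace (X n)] (𝒢 : ∀ n, Set (Set (X n)))
    (f : ∀ n, X (n + 1) → X n) (x₀ : InverseLimit f) : Set (Set (LimitSpace f x₀)) :=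
  {Q | Q.Nonempty ∧ ∃ P : ∀ n, Set (X n), IsCoherent 𝒢 f P ∧
    Q = {x | ∀ n, LimitSpace.proj f x₀ n x ∈ P n}}

/-! Local path-connectedness is built into the coreflection, and `Lpc` of a metric space is metrized
by the infimum of the diameters of paths between two points. By coherence, a point lies in a limit
piece exactly when every coordinate lies in the piece-portion. This gives closedness. Each limit
piece is parametrized by a late `P n`: a section is continuous into the finer topology because
pieces are locally path-connected. Projecting paths to each level then identifies the limit pieces
as path components.

The substance is the simple closed curve axiom, carried by `LimitSpace.not_injOn_of_notMem`. Suppose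
a simple closed curve has a point whose `n`-th coordinate avoids all pieces. A short subarc around
that parameter avoids pieces at every level from `n` on. In a tree-graded space, an arc avoiding the
pieces lies in every path with the same ends, so at level `m` the projected subarc and the projected
rest of the curve share an arc. For large `m`, compactness keeps the middle of the subarc off the
rest and its two outer thirds apart, so the shared arc would be disconnected. Hence the curve lies
in the piece-portion and, being path-connected, in one piece.

The tree-graded facts rest on `Path.exists_injective`: a path between distinct points contains an
arc between them. -/

/-! ### The locally path-connected coreflection -/

namespace Lpc

variable {Z : Type*} [TopologicalSpace Z]

theorem toBase_injective (Z : Type*) : Function.Injective (toBase : Lpc Z → Z) := by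
  rintro ⟨x⟩ ⟨y⟩ h
  exact congrArg mk h

theorem isTopologicalBasis : TopologicalSpace.IsTopologicalBasis
    {W : Set (Lpc Z) | ∃ U : Set Z, IsOpen U ∧ ∃ x ∈ U, W = toBase ⁻¹' pathComponentIn U x} where
  exists_subset_inter := by
    rintro _ ⟨U, hU, x, -, rfl⟩ _ ⟨V, hV, y, -, rfl⟩ z ⟨hzU, hzV⟩
    refine ⟨_, ⟨U ∩ V, hU.inter hV, z.toBase,
      ⟨pathComponentIn_subset hzU, pathComponentIn_subset hzV⟩, rfl⟩,
      mem_pathComponentIn_self ⟨pathComponentIn_subset hzU, pathComponentIn_subset hzV⟩, ?_⟩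
    rw [← pathComponentIn_congr hzU, ← pathComponentIn_congr hzV]
    exact subset_inter (preimage_mono (pathComponentIn_mono inter_subset_left))
      (preimage_mono (pathComponentIn_mono inter_subset_right))
  sUnion_eq := by
    refine eq_univ_of_forall fun x => ⟨_, ⟨univ, isOpen_univ, x.toBase, mem_univ _, rfl⟩, ?_⟩
    exact mem_pathComponentIn_self (mem_univ _)
  eq_generateFrom := rfl

theorem nhds_hasBasis (x : Lpc Z) : (𝓝 x).HasBasis (fun U : Set Z => IsOpen U ∧ x.toBase ∈ U)
    fun U => toBase ⁻¹' pathComponentIn U x.toBase := by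
  refine ⟨fun s => ?_⟩
  rw [isTopologicalBasis.mem_nhds_iff]
  constructor
  · rintro ⟨_, ⟨U, hU, y, -, rfl⟩, hx, hs⟩
    exact ⟨U, ⟨hU, pathComponentIn_subset hx⟩, by rwa [pathComponentIn_congr hx]⟩
  · rintro ⟨U, ⟨hU, hx⟩, hs⟩
    exact ⟨_, ⟨U, hU, _, hx, rfl⟩, mem_pathComponentIn_self hx, hs⟩

theorem continuous_toBase : Continuous (toBase : Lpc Z → Z) := by
  rw [continuous_iff_continuousAt]
  intro x s hs
  obtain ⟨U, hUs, hU, hx⟩ := mem_nhds_iff.1 hs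
  exact (nhds_hasBasis x).mem_of_superset ⟨hU, hx⟩
    (preimage_mono (pathComponentIn_subset.trans hUs))

/-- Universal property of the coreflection: near `y`, the path component of the preimage of `U` is a
neighbourhood, and its paths map to paths in `U`. It lifts both paths and parametrizations of
pieces. -/
theorem continuous_of_toBase {Y : Type*} [TopologicalSpace Y] [LocallyPathConnectedSpace Y]
    {g : Y → Lpc Z} (hg : Continuous fun y => (g y).toBase) : Continuous g := by
  rw [continuous_iff_continuousAt]
  intro y
  rw [ContinuousAt, (nhds_hasBasis (g y)).tendsto_right_iff]
  rintro U ⟨hU, hy⟩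
  filter_upwards [pathComponentIn_mem_nhds (hg.continuousAt.preimage_mem_nhds (hU.mem_nhds hy))]
    with z hz
  exact (JoinedIn.map hz hg).mono (image_preimage_subset _ _)

instance : LocallyPathConnectedSpace unitInterval :=
  (convex_Icc (0 : ℝ) 1).locallyPathConnectedSpace

instance : PathConnectedSpace unitInterval := .of_locallyPathConnectedSpace

/-- A path in the base space, as a path in the coreflection. -/
def liftPath {x y : Lpc Z} (γ : Path x.toBase y.toBase) : Path x y where
  toFun t := ⟨γ t⟩
  continuous_toFun := continuous_of_toBase γ.continuous
  source' := toBase_injective Z γ.source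
  target' := toBase_injective Z γ.target

theorem joinedIn_preimage {F : Set Z} {x y : Lpc Z} (h : JoinedIn F x.toBase y.toBase) :
    JoinedIn (toBase ⁻¹' F) x y :=
  ⟨liftPath h.somePath, h.somePath_mem⟩

instance [PathConnectedSpace Z] : PathConnectedSpace (Lpc Z) where
  nonempty := ⟨⟨Classical.arbitrary Z⟩⟩
  joined x y := ⟨liftPath (PathConnectedSpace.somePath x.toBase y.toBase)⟩

instance : LocallyPathConnectedSpace (Lpc Z) := by
  refine .of_bases nhds_hasBasis ?_
  rintro x U ⟨-, hx⟩
  refine ⟨x, mem_pathComponentIn_self hx, fun {y} hy => joinedIn_preimage ?_⟩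
  exact (isPathConnected_pathComponentIn hx).joinedIn _ (mem_pathComponentIn_self hx) _ hy

instance [T2Space Z] : T2Space (Lpc Z) :=
  .of_injective_continuous (toBase_injective Z) continuous_toBase

end Lpc

/-! ### Metrizability of the coreflection -/

/-- The extended metric on a metric space that assigns to two points the infimum of the diameters
of the paths between them. -/
noncomputable abbrev pathDiamEMetric (Z : Type*) [PseudoEMetricSpace Z] :
    PseudoEMetricSpace (Lpc Z) where
  edist x y := ⨅ γ : Path x.toBase y.toBase, Metric.ediam (range γ)
  edist_self x := by
    refine le_antisymm (iInf_le_of_le (Path.refl _) ?_) zero_le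
    simp
  edist_comm x y := by
    refine le_antisymm ?_ ?_ <;>
    exact le_iInf fun γ => iInf_le_of_le γ.symm (by rw [Path.symm_range])
  edist_triangle x y z := by
    refine ENNReal.le_of_forall_pos_le_add fun ε hε h => ?_
    have hε' : (ε / 2 : ENNReal) ≠ 0 := by simp [hε.ne']
    obtain ⟨h₁, h₂⟩ := ENNReal.add_lt_top.1 h
    obtain ⟨γ, hγ⟩ := iInf_lt_iff.1 (ENNReal.lt_add_right h₁.ne hε')
    obtain ⟨δ, hδ⟩ := iInf_lt_iff.1 (ENNReal.lt_add_right h₂.ne hε')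
    refine (iInf_le _ (γ.trans δ)).trans ?_
    rw [Path.trans_range]
    have hne : (range γ ∩ range δ).Nonempty := ⟨y.toBase, ⟨1, γ.target⟩, ⟨0, δ.source⟩⟩
    refine (Metric.ediam_union_le hne).trans ?_
    refine (add_le_add hγ.le hδ.le).trans_eq ?_
    rw [add_add_add_comm, ENNReal.add_halves]

theorem pathDiamEMetric_topology (Z : Type*) [PseudoEMetricSpace Z] :
    (pathDiamEMetric Z).toUniformSpace.toTopologicalSpace = Lpc.instTopologicalSpace Z := by
  refine TopologicalSpace.ext_nhds fun x => ?_
  refine (@Metric.nhds_basis_eball _ (pathDiamEMetric Z) x).ext (Lpc.nhds_hasBasis x) ?_ ?_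
  · intro ε hε
    -- A path inside a ball of radius `δ` has diameter at most `2 * δ`.
    obtain ⟨δ, hδ, hδε⟩ : ∃ δ : ENNReal, 0 < δ ∧ 2 * δ < ε := by
      obtain ⟨η, hη, hηε⟩ := exists_between hε
      refine ⟨η / 2, ENNReal.div_pos hη.ne' (by simp), ?_⟩
      rwa [ENNReal.mul_div_cancel (by simp) (by simp)]
    refine ⟨Metric.eball x.toBase δ, ⟨Metric.isOpen_eball, Metric.mem_eball_self hδ⟩, ?_⟩
    intro y hy
    obtain ⟨γ, hγ⟩ := JoinedIn.symm hy
    refine (iInf_le _ γ).trans_lt (lt_of_le_of_lt ?_ hδε)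
    exact (Metric.ediam_mono (range_subset_iff.2 hγ)).trans Metric.ediam_eball_le
  · rintro U ⟨hU, hx⟩
    obtain ⟨ε, hε, hεU⟩ := EMetric.isOpen_iff.1 hU _ hx
    refine ⟨ε, hε, fun y hy => ?_⟩
    obtain ⟨γ, hγ⟩ := iInf_lt_iff.1 ((@edist_comm _ (pathDiamEMetric Z) x y).trans_lt hy)
    refine ⟨γ, fun t => hεU ?_⟩
    refine (Metric.edist_le_ediam_of_mem (mem_range_self t) ⟨0, γ.source⟩).trans_lt hγ

instance Lpc.instMetrizableSpace {Z : Type*} [TopologicalSpace Z]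
    [TopologicalSpace.MetrizableSpace Z] : TopologicalSpace.MetrizableSpace (Lpc Z) := by
  let := TopologicalSpace.metrizableSpaceMetric Z
  have : TopologicalSpace.PseudoMetrizableSpace (Lpc Z) := by
    rw [← pathDiamEMetric_topology Z]
    let := pathDiamEMetric Z
    infer_instance
  infer_instance

/-! ### Arcs inside paths, by a minimal set of parameters -/

/-- A closed set of parameters in `[0, 1]` containing the end points such that `γ` takes equal values
at the end points of each gap. -/
structure IsShortcut {X : Type*} (γ : ℝ → X) (F : Set ℝ) : Prop where
  isClosed : IsClosed F
  subset : F ⊆ Icc 0 1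
  zero_mem : 0 ∈ F
  one_mem : 1 ∈ F
  eq_of_gap : ∀ s ∈ F, ∀ t ∈ F, s < t → (∀ r ∈ F, r ∉ Ioo s t) → γ s = γ t

namespace IsShortcut

variable {X : Type*} {γ : ℝ → X} {F : Set ℝ}

theorem isCompact (hF : IsShortcut γ F) : IsCompact F :=
  isCompact_Icc.of_isClosed_subset hF.isClosed hF.subset

theorem icc : IsShortcut γ (Icc 0 1) where
  isClosed := isClosed_Icc
  subset := Subset.rfl
  zero_mem := by simp
  one_mem := by simp
  eq_of_gap s hs t ht hst h := by
    refine absurd ⟨?_, ?_⟩ (h ((s + t) / 2) ⟨?_, ?_⟩) <;> linarith [hs.1, ht.2]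

/-- Across a gap, a shortcut set has a last point before and a first point after it. -/
theorem exists_eq_of_disjoint (hF : IsShortcut γ F) {s s' t' t : ℝ} (hs : s ∈ F) (ht : t ∈ F)
    (hss : s ≤ s') (hst : s' < t') (htt : t' ≤ t) (h : Disjoint F (Icc s' t')) :
    ∃ a ∈ F ∩ Icc s s', ∃ b ∈ F ∩ Icc t' t, γ a = γ b := by
  obtain ⟨a, ha, ha'⟩ := (hF.isCompact.inter_right isClosed_Icc).exists_isGreatest
    (⟨s, hs, le_rfl, hss⟩ : (F ∩ Icc s s').Nonempty)
  obtain ⟨b, hb, hb'⟩ := (hF.isCompact.inter_right isClosed_Icc).exists_isLeast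
    (⟨t, ht, htt, le_rfl⟩ : (F ∩ Icc t' t).Nonempty)
  refine ⟨a, ha, b, hb, hF.eq_of_gap a ha.1 b hb.1 (by linarith [ha.2.2, hb.2.1]) ?_⟩
  intro r hr hab
  rcases le_or_gt r s' with h1 | h1
  · exact hab.1.not_ge (ha' ⟨hr, ha.2.1.trans hab.1.le, h1⟩)
  rcases le_or_gt t' r with h2 | h2
  · exact hab.2.not_ge (hb' ⟨hr, h2, hab.2.le.trans hb.2.2⟩)
  · exact disjoint_left.1 h hr ⟨h1.le, h2.le⟩

/-- Chains have lower bounds for Zorn's lemma. A gap of the intersection is almost a gap of some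
member, so its end values are arbitrarily close. -/
theorem sInter [MetricSpace X] (hγ : Continuous γ) {c : Set (Set ℝ)} (hc : ∀ F ∈ c, IsShortcut γ F)
    (hchain : IsChain (· ⊆ ·) c) (hne : c.Nonempty) : IsShortcut γ (⋂₀ c) where
  isClosed := isClosed_sInter fun F hF => (hc F hF).isClosed
  subset := let ⟨F, hF⟩ := hne; (sInter_subset_of_mem hF).trans (hc F hF).subset
  zero_mem F hF := (hc F hF).zero_mem
  one_mem F hF := (hc F hF).one_mem
  eq_of_gap s hs t ht hst h := by
    refine eq_of_forall_dist_le fun ε hε => ?_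
    obtain ⟨δ₁, hδ₁, h₁⟩ := Metric.continuous_iff.1 hγ s (ε / 2) (half_pos hε)
    obtain ⟨δ₂, hδ₂, h₂⟩ := Metric.continuous_iff.1 hγ t (ε / 2) (half_pos hε)
    obtain ⟨η, hη, hηm⟩ := exists_between (lt_min (lt_min hδ₁ hδ₂) (by linarith : 0 < (t - s) / 2))
    rw [lt_min_iff, lt_min_iff] at hηm
    have := hne.to_subtype
    -- By compactness a single member of the chain already misses `[s + η, t - η]`.
    obtain ⟨⟨F, hF⟩, hFd⟩ := (isCompact_Icc (a := s + η) (b := t - η)).elim_directed_cover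
      (fun F : c => (F : Set ℝ)ᶜ) (fun F => (hc F F.2).isClosed.isOpen_compl) (by
        intro r hr
        by_contra hr'
        simp only [mem_iUnion, mem_compl_iff, not_exists, not_not] at hr'
        exact h r (fun F hF => hr' ⟨F, hF⟩) ⟨by linarith [hr.1], by linarith [hr.2]⟩)
      (fun F G => by
        rcases hchain.total F.2 G.2 with h | h
        · exact ⟨F, Subset.rfl, compl_subset_compl.2 h⟩
        · exact ⟨G, compl_subset_compl.2 h, Subset.rfl⟩)
    obtain ⟨a, ha, b, hb, hab⟩ := (hc F hF).exists_eq_of_disjoint (hs F hF) (ht F hF)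
      (by linarith : s ≤ s + η) (by linarith : s + η < t - η) (by linarith)
      (disjoint_left.2 fun r hr hr' => hFd hr' hr)
    have ha' := h₁ a (by rw [Real.dist_eq, abs_lt]; constructor <;> linarith [ha.2.1, ha.2.2])
    have hb' := h₂ b (by rw [Real.dist_eq, abs_lt]; constructor <;> linarith [hb.2.1, hb.2.2])
    rw [hab] at ha'
    linarith [dist_triangle_left (γ s) (γ t) (γ b)]

/-- Cutting out the open interval between two parameters with the same value. -/
theorem diff_Ioo (hF : IsShortcut γ F) {s t : ℝ} (hs : s ∈ F) (ht : t ∈ F) (hst : s < t)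
    (h : γ s = γ t) : IsShortcut γ (F \ Ioo s t) where
  isClosed := hF.isClosed.sdiff isOpen_Ioo
  subset := sdiff_subset.trans hF.subset
  zero_mem := ⟨hF.zero_mem, fun h' => h'.1.not_ge (hF.subset hs).1⟩
  one_mem := ⟨hF.one_mem, fun h' => h'.2.not_ge (hF.subset ht).2⟩
  eq_of_gap a ha b hb hab hgap := by
    by_cases hr : ∃ r ∈ F, r ∈ Ioo a b
    · obtain ⟨r, hrF, hr⟩ := hr
      have hrst : r ∈ Ioo s t := by
        by_contra hrst
        exact hgap r ⟨hrF, hrst⟩ hr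
      -- The ends of the new gap avoid `(s, t)`, while `s` and `t` avoid the gap; as both intervals
      -- contain `r`, they coincide.
      have hs' := hgap s ⟨hs, fun h => h.1.false⟩
      have ht' := hgap t ⟨ht, fun h => h.2.false⟩
      have ha' := ha.2
      have hb' := hb.2
      simp only [mem_Ioo, not_and, not_lt] at *
      obtain rfl : a = s := by grind
      obtain rfl : b = t := by grind
      exact h
    · exact hF.eq_of_gap a ha.1 b hb.1 hab fun r hrF hr' => hr ⟨r, hrF, hr'⟩

theorem exists_minimal [MetricSpace X] (hγ : Continuous γ) : ∃ F, IsShortcut γ F ∧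
    ∀ s ∈ F, ∀ t ∈ F, s < t → γ s = γ t → ∀ r ∈ F, r ∉ Ioo s t := by
  obtain ⟨F, -, hF, hmin⟩ := zorn_superset_nonempty {F | IsShortcut γ F}
    (fun c hc hchain hne => ⟨⋂₀ c, sInter hγ hc hchain hne, fun s hs => sInter_subset_of_mem hs⟩)
    (Icc 0 1) icc
  exact ⟨F, hF, fun s hs t ht hst h r hr hr' =>
    (hmin (hF.diff_Ioo hs ht hst h) sdiff_subset hr).2 hr'⟩

/-- The part of the image of the shortcut set that is visited up to time `t`. -/
def trace (γ : ℝ → X) (F : Set ℝ) (t : ℝ) : Set X := γ '' (F ∩ Icc 0 t)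

theorem trace_mono {s t : ℝ} (h : s ≤ t) : trace γ F s ⊆ trace γ F t :=
  image_mono (inter_subset_inter_right _ (Icc_subset_Icc_right h))

theorem zero_mem_trace (hF : IsShortcut γ F) {t : ℝ} (ht : 0 ≤ t) : γ 0 ∈ trace γ F t :=
  mem_image_of_mem _ ⟨hF.zero_mem, le_rfl, ht⟩

theorem mem_trace (hF : IsShortcut γ F) {t : ℝ} (ht : t ∈ F) : γ t ∈ trace γ F t :=
  mem_image_of_mem _ ⟨ht, (hF.subset ht).1, le_rfl⟩

/-- Nothing is visited inside a gap, so rounding `t` down to a point of `F` leaves the trace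
unchanged. -/
theorem exists_last (hF : IsShortcut γ F) {t : ℝ} (ht : 0 ≤ t) :
    ∃ a ∈ F, a ≤ t ∧ trace γ F a = trace γ F t ∧ ∀ r ∈ F, r ≤ t → r ≤ a := by
  obtain ⟨a, ha, ha'⟩ := (hF.isCompact.inter_right isClosed_Icc).exists_isGreatest
    (⟨0, hF.zero_mem, le_rfl, ht⟩ : (F ∩ Icc 0 t).Nonempty)
  have hlast : ∀ r ∈ F, r ≤ t → r ≤ a := fun r hr hrt => ha' ⟨hr, (hF.subset hr).1, hrt⟩
  refine ⟨a, ha.1, ha.2.2, (trace_mono ha.2.2).antisymm ?_, hlast⟩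
  exact image_mono fun r hr => ⟨hr.1, hr.2.1, hlast r hr.1 hr.2.2⟩

/-- By minimality no parameter of `F` lies strictly between `s` and `t`, so only the value `γ t = γ
s` could be added. -/
theorem trace_eq_of_eq (hF : IsShortcut γ F)
    (hmin : ∀ s ∈ F, ∀ t ∈ F, s < t → γ s = γ t → ∀ r ∈ F, r ∉ Ioo s t)
    {s t : ℝ} (hs : s ∈ F) (ht : t ∈ F) (h : γ s = γ t) : trace γ F s = trace γ F t := by
  wlog hst : s ≤ t generalizing s t
  · exact (this ht hs h.symm (le_of_not_ge hst)).symm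
  refine (trace_mono hst).antisymm ?_
  rintro _ ⟨r, ⟨hr, hrt⟩, rfl⟩
  rcases le_or_gt r s with h1 | h1
  · exact ⟨r, ⟨hr, hrt.1, h1⟩, rfl⟩
  · have : r = t := hrt.2.eq_of_not_lt fun h2 => hmin s hs t ht (h1.trans h2) h r hr ⟨h1, h2⟩
    rw [this, ← h]
    exact hF.mem_trace hs

/-- An earlier visit to `γ t` would let minimality exclude `s` from `F`. -/
theorem notMem_trace
    (hmin : ∀ s ∈ F, ∀ t ∈ F, s < t → γ s = γ t → ∀ r ∈ F, r ∉ Ioo s t)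
    {s t : ℝ} (hs : s ∈ F) (ht : t ∈ F) (hst : s < t) (h : γ s ≠ γ t) : γ t ∉ trace γ F s := by
  rintro ⟨r, ⟨hr, hrs⟩, hrt⟩
  have : r < s := hrs.2.lt_of_ne fun h' => h (h' ▸ hrt)
  exact hmin r hr t ht (this.trans hst) hrt s hs ⟨this, hst⟩

/-- A value newly visited at `r` is close to the value at the first parameter `b` of `F` after `s`.
The latter was already visited, since `b` ends the gap containing `s`. -/
theorem trace_approx [MetricSpace X] (hγ : Continuous γ) (hF : IsShortcut γ F) {ε : ℝ}
    (hε : 0 < ε) : ∃ δ > 0, ∀ s ∈ Icc (0 : ℝ) 1, ∀ t ∈ Icc (0 : ℝ) 1, s ≤ t → t - s < δ →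
      ∀ p ∈ trace γ F t, ∃ p' ∈ trace γ F s, dist p' p < ε := by
  obtain ⟨δ, hδ, h⟩ := Metric.uniformContinuousOn_iff.1
    (isCompact_Icc.uniformContinuousOn_of_continuous (s := Icc (0 : ℝ) 1) hγ.continuousOn) ε hε
  refine ⟨δ, hδ, ?_⟩
  rintro s hs t ht hst hδst _ ⟨r, ⟨hr, hrt⟩, rfl⟩
  rcases le_or_gt r s with h1 | h1
  · exact ⟨γ r, ⟨r, ⟨hr, hrt.1, h1⟩, rfl⟩, by simpa⟩
  obtain ⟨a, ha, has, -, hlast⟩ := hF.exists_last (γ := γ) hs.1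
  obtain ⟨b, hb, hb'⟩ := (hF.isCompact.inter_right isClosed_Icc).exists_isLeast
    (⟨r, hr, h1.le, le_rfl⟩ : (F ∩ Icc s r).Nonempty)
  have hab : γ a = γ b := by
    rcases (has.trans hb.2.1).eq_or_lt with h2 | h2
    · rw [h2]
    refine hF.eq_of_gap a ha b hb.1 h2 fun x hx hx' => ?_
    rcases le_or_gt x s with h3 | h3
    · exact hx'.1.not_ge (hlast x hx h3)
    · exact hx'.2.not_ge (hb' ⟨hx, h3.le, hx'.2.le.trans hb.2.2⟩)
  refine ⟨γ a, ⟨a, ⟨ha, (hF.subset ha).1, has⟩, rfl⟩, ?_⟩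
  rw [hab]
  refine h b (hF.subset hb.1) r (hF.subset hr) ?_
  rw [Real.dist_eq, abs_lt]
  constructor <;> linarith [hb.2.1, hb.2.2, hrt.2]

theorem continuousOn_infDist_trace [MetricSpace X] (hγ : Continuous γ) (hF : IsShortcut γ F)
    (x : X) : ContinuousOn (fun t => Metric.infDist x (trace γ F t)) (Icc 0 1) := by
  rw [Metric.continuousOn_iff]
  intro t ht ε hε
  obtain ⟨δ, hδ, h⟩ := hF.trace_approx hγ (half_pos hε)
  have key : ∀ s ∈ Icc (0 : ℝ) 1, ∀ t ∈ Icc (0 : ℝ) 1, s ≤ t → t - s < δ →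
      dist (Metric.infDist x (trace γ F s)) (Metric.infDist x (trace γ F t)) < ε := by
    intro s hs t ht hst hδst
    have h1 := Metric.infDist_le_infDist_of_subset (x := x) (trace_mono (γ := γ) (F := F) hst)
      ⟨_, hF.zero_mem_trace hs.1⟩
    have h2 : Metric.infDist x (trace γ F s) - ε / 2 ≤ Metric.infDist x (trace γ F t) := by
      refine (Metric.le_infDist ⟨_, hF.zero_mem_trace ht.1⟩).2 fun p hp => ?_
      obtain ⟨p', hp', hpp⟩ := h s hs t ht hst hδst p hp
      linarith [Metric.infDist_le_dist_of_mem (x := x) hp', dist_triangle_right x p' p]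
    rw [Real.dist_eq, abs_lt]
    constructor <;> linarith
  refine ⟨δ, hδ, fun s hs hst => ?_⟩
  rw [Real.dist_eq, abs_lt] at hst
  rcases le_total s t with h' | h'
  · exact key s hs t ht h' (by linarith)
  · rw [dist_comm]
    exact key t ht s hs h' (by linarith)

/-- A decreasing coordinate along the shortcut set whose level sets are those of `γ`. -/
theorem exists_coordinate [MetricSpace X] (hγ : Continuous γ) (hF : IsShortcut γ F)
    (hmin : ∀ s ∈ F, ∀ t ∈ F, s < t → γ s = γ t → ∀ r ∈ F, r ∉ Ioo s t) :
    ∃ ψ : ℝ → ℝ, ContinuousOn ψ (Icc 0 1) ∧ ψ '' F = Icc (ψ 1) (ψ 0) ∧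
      ∀ s ∈ F, ∀ t ∈ F, ψ s = ψ t ↔ γ s = γ t := by
  -- The coordinate is a weighted sum of distances from a dense sequence of points on the path to
  -- the growing trace. Each summand is continuous and decreasing.
  let q : ℕ → unitInterval := TopologicalSpace.denseSeq unitInterval
  let φ : ℕ → ℝ → ℝ := fun n t => (1 / 2) ^ n * Metric.infDist (γ (q n)) (trace γ F t)
  let D : ℝ := Metric.diam (γ '' Icc 0 1)
  have hbdd : Bornology.IsBounded (γ '' Icc (0 : ℝ) 1) :=
    (isCompact_Icc.image hγ).isBounded
  have hsum : Summable fun n : ℕ => (1 / 2 : ℝ) ^ n * D :=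
    summable_geometric_two.mul_right D
  have hφ0 : ∀ n t, 0 ≤ φ n t := fun n t => mul_nonneg (by positivity) Metric.infDist_nonneg
  have hφD : ∀ n t, t ∈ Icc (0 : ℝ) 1 → φ n t ≤ (1 / 2) ^ n * D := by
    intro n t ht
    refine mul_le_mul_of_nonneg_left ?_ (by positivity)
    refine (Metric.infDist_le_dist_of_mem (hF.zero_mem_trace ht.1)).trans ?_
    exact Metric.dist_le_diam_of_mem hbdd ⟨_, (q n).2, rfl⟩ ⟨0, by simp, rfl⟩
  have hφs : ∀ t ∈ Icc (0 : ℝ) 1, Summable fun n => φ n t := fun t ht =>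
    .of_nonneg_of_le (fun n => hφ0 n t) (fun n => hφD n t ht) hsum
  have hφm : ∀ n, ∀ s ∈ Icc (0 : ℝ) 1, ∀ t, s ≤ t → φ n t ≤ φ n s := fun n s hs t hst =>
    mul_le_mul_of_nonneg_left (Metric.infDist_le_infDist_of_subset (trace_mono hst)
      ⟨_, hF.zero_mem_trace hs.1⟩) (by positivity)
  let ψ : ℝ → ℝ := fun t => ∑' n, φ n t
  have hψc : ContinuousOn ψ (Icc 0 1) := by
    refine continuousOn_tsum (fun n => ?_) hsum fun n t ht => ?_
    · exact continuousOn_const.mul (hF.continuousOn_infDist_trace hγ _)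
    · rw [Real.norm_of_nonneg (hφ0 n t)]
      exact hφD n t ht
  have hψm : ∀ s ∈ Icc (0 : ℝ) 1, ∀ t ∈ Icc (0 : ℝ) 1, s ≤ t → ψ t ≤ ψ s := fun s hs t ht hst =>
    (hφs t ht).tsum_le_tsum (fun n => hφm n s hs t hst) (hφs s hs)
  have hψtr : ∀ s t, trace γ F s = trace γ F t → ψ s = ψ t := by
    intro s t h
    simp only [ψ, φ, h]
  have hψlt : ∀ s ∈ F, ∀ t ∈ F, s < t → γ s ≠ γ t → ψ t < ψ s := by
    intro s hs t ht hst h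
    have hsI := hF.subset hs
    have htI := hF.subset ht
    have hcl : IsClosed (trace γ F s) :=
      ((hF.isCompact.inter_right isClosed_Icc).image hγ).isClosed
    have hpos := (hcl.notMem_iff_infDist_pos ⟨_, hF.zero_mem_trace hsI.1⟩).1
      (notMem_trace hmin hs ht hst h)
    set d := Metric.infDist (γ t) (trace γ F s)
    -- A sample point within `d / 2` of `γ t` is farther than `d / 2` from the trace up to `s`, so
    -- its summand strictly drops.
    have hopen : IsOpen {r : unitInterval | dist (γ r) (γ t) < d / 2} :=
      isOpen_lt (by fun_prop) continuous_const
    obtain ⟨n, hn⟩ := (TopologicalSpace.denseRange_denseSeq unitInterval).exists_mem_open hopen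
      ⟨⟨t, htI⟩, by simpa using hpos⟩
    refine (hφs t htI).tsum_lt_tsum (fun n => hφm n s hsI t hst.le) (i := n) ?_ (hφs s hsI)
    refine mul_lt_mul_of_pos_left ?_ (by positivity)
    have h1 := Metric.infDist_le_dist_of_mem (x := γ (q n)) (hF.mem_trace ht)
    have h2 : d ≤ _ := Metric.infDist_le_infDist_add_dist (x := γ t) (y := γ (q n))
    rw [dist_comm] at h2
    change dist (γ (q n)) (γ t) < d / 2 at hn
    linarith
  refine ⟨ψ, hψc, ?_, fun s hs t ht => ⟨fun h => ?_, fun h => ?_⟩⟩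
  · refine Subset.antisymm ?_ fun y hy => ?_
    · rintro _ ⟨t, ht, rfl⟩
      have htI := hF.subset ht
      exact ⟨hψm t htI 1 (by simp) htI.2, hψm 0 (by simp) t htI htI.1⟩
    · obtain ⟨t, ht, rfl⟩ := intermediate_value_Icc' zero_le_one hψc hy
      obtain ⟨a, ha, -, hat, -⟩ := hF.exists_last (γ := γ) ht.1
      exact ⟨a, ha, hψtr _ _ hat⟩
  · by_contra hne
    rcases lt_trichotomy s t with hst | rfl | hst
    · exact (hψlt s hs t ht hst hne).ne' h
    · exact hne rfl
    · exact (hψlt t ht s hs hst (Ne.symm hne)).ne h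
  · exact hψtr _ _ (hF.trace_eq_of_eq hmin hs ht h)

end IsShortcut

/-- Two distinct points joined by a path in a metric space are joined by an injective path inside
its range. -/
theorem Path.exists_injective {X : Type*} [TopologicalSpace X] [TopologicalSpace.MetrizableSpace X]
    {x y : X} (γ : Path x y) (hxy : x ≠ y) :
    ∃ a : Path x y, Function.Injective a ∧ range a ⊆ range γ := by
  let := TopologicalSpace.metrizableSpaceMetric X
  obtain ⟨F, hF, hmin⟩ := IsShortcut.exists_minimal γ.continuous_extend
  obtain ⟨ψ, hψc, hψF, hψ⟩ := hF.exists_coordinate γ.continuous_extend hmin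
  have hne : ψ 0 ≠ ψ 1 := fun h => hxy (by
    simpa using (hψ 0 hF.zero_mem 1 hF.one_mem).1 h)
  -- The arc is parametrized by affine height: at time `t` it takes the value of `γ` at any `s ∈ F`
  -- with `ψ s = l t`. Continuity follows as `ψ` maps compact subsets of `F` to closed sets.
  let l : unitInterval → ℝ := fun t => ψ 0 + t * (ψ 1 - ψ 0)
  have hle : ψ 1 ≤ ψ 0 := by
    have : ψ 0 ∈ Icc (ψ 1) (ψ 0) := hψF ▸ mem_image_of_mem ψ hF.zero_mem
    exact this.1
  have hl : ∀ t, ∃ s ∈ F, ψ s = l t := by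
    intro t
    have : l t ∈ Icc (ψ 1) (ψ 0) := by
      constructor <;> simp only [l] <;> nlinarith [t.2.1, t.2.2]
    rwa [← hψF] at this
  have hlinj : Function.Injective l := by
    intro s t h
    have : (s : ℝ) = t := by
      simpa [l, sub_eq_zero, hne.symm] using h
    exact Subtype.ext this
  have hlc : Continuous l := by fun_prop
  choose σ hσF hσ using hl
  have hext : ∀ t ∈ F, ∀ s, ψ t = l s → γ.extend (σ s) = γ.extend t := fun t ht s h =>
    (hψ _ (hσF s) t ht).1 ((hσ s).trans h.symm)
  refine ⟨⟨⟨fun t => γ.extend (σ t), ?_⟩, ?_, ?_⟩, ?_, ?_⟩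
  · refine continuous_iff_isClosed.2 fun C hC => ?_
    have : (fun t => γ.extend (σ t)) ⁻¹' C = l ⁻¹' (ψ '' (F ∩ γ.extend ⁻¹' C)) := by
      ext t
      constructor
      · exact fun ht => ⟨σ t, ⟨hσF t, ht⟩, hσ t⟩
      · rintro ⟨s, ⟨hs, hsC⟩, hst⟩
        rw [mem_preimage, hext s hs t hst]
        exact hsC
    rw [this]
    refine IsClosed.preimage hlc (IsCompact.isClosed ?_)
    exact (hF.isCompact.inter_right (hC.preimage γ.continuous_extend)).image_of_continuousOn
      (hψc.mono (inter_subset_left.trans hF.subset))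
  · simpa using hext 0 hF.zero_mem 0 (by simp [l])
  · simpa using hext 1 hF.one_mem 1 (by simp [l])
  · intro s t h
    exact hlinj ((hσ s).symm.trans (((hψ _ (hσF s) _ (hσF t)).2 h).trans (hσ t)))
  · rintro _ ⟨t, rfl⟩
    rw [← γ.extend_range]
    exact mem_range_self (σ t)

/-! ### Simple closed curves from arcs -/

/-- Two injective paths that meet only at their end points form a simple closed curve. -/
theorem isSimpleClosedCurve_range_union_range {X : Type*} [TopologicalSpace X] [T2Space X] {u v : X}
    (p : Path u v) (b : Path v u) (hp : Function.Injective p) (hb : Function.Injective b)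
    (h : ∀ s t, p s = b t → p s = u ∨ p s = v) : IsSimpleClosedCurve (range p ∪ range b) := by
  have hpe : InjOn p.extend (Icc 0 1) := by
    intro s hs t ht hst
    rw [p.extend_apply hs, p.extend_apply ht] at hst
    simpa using hp hst
  have hbe : InjOn b.extend (Icc 0 1) := by
    intro s hs t ht hst
    rw [b.extend_apply hs, b.extend_apply ht] at hst
    simpa using hb hst
  have hmix : ∀ s ∈ Icc (0 : ℝ) 1, ∀ t ∈ Ioo (0 : ℝ) 1, p.extend s ≠ b.extend t := by
    intro s hs t ht hst
    have htI := Ioo_subset_Icc_self ht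
    have h' := h ⟨s, hs⟩ ⟨t, htI⟩ (by rwa [p.extend_apply hs, b.extend_apply htI] at hst)
    rw [← p.extend_apply hs, hst] at h'
    rcases h' with h' | h'
    · exact ht.2.ne (hbe htI (by simp) (h'.trans b.extend_one.symm))
    · exact ht.1.ne' (hbe htI (by simp) (h'.trans b.extend_zero.symm))
  set f := (p.trans b).extend with hf
  have hf01 : f 0 = f 1 := by simp [hf]
  have hc : Continuous (AddCircle.liftIco (1 : ℝ) 0 f) :=
    AddCircle.liftIco_zero_continuous hf01 (p.trans b).continuous_extend.continuousOn
  have hinj : InjOn f (Ico 0 1) := by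
    intro s hs t ht hst
    wlog hle : s ≤ t generalizing s t
    · exact (this ht hs hst.symm (le_of_not_ge hle)).symm
    rcases le_or_gt t (1 / 2) with h2 | h2
    · rw [hf, Path.extend_trans_of_le_half _ _ h2, Path.extend_trans_of_le_half _ _ (hle.trans h2)]
        at hst
      have := hpe ⟨by linarith [hs.1], by linarith⟩ ⟨by linarith [ht.1], by linarith⟩ hst
      linarith
    rcases le_or_gt s (1 / 2) with h1 | h1
    · rw [hf, Path.extend_trans_of_half_le _ _ h2.le, Path.extend_trans_of_le_half _ _ h1] at hst
      exact absurd hst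
        (hmix _ ⟨by linarith [hs.1], by linarith⟩ _ ⟨by linarith, by linarith [ht.2]⟩)
    · rw [hf, Path.extend_trans_of_half_le _ _ h2.le, Path.extend_trans_of_half_le _ _ h1.le] at hst
      have := hbe ⟨by linarith [hs.1], by linarith [hs.2]⟩
        ⟨by linarith [ht.1], by linarith [ht.2]⟩ hst
      linarith
  have hinj' : Function.Injective (AddCircle.liftIco (1 : ℝ) 0 f) := by
    intro s t hst
    obtain ⟨s, hs, rfl⟩ := AddCircle.eq_coe_Ico s
    obtain ⟨t, ht, rfl⟩ := AddCircle.eq_coe_Ico t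
    rw [AddCircle.liftIco_zero_coe_apply hs, AddCircle.liftIco_zero_coe_apply ht] at hst
    rw [hinj hs ht hst]
  have hrange : range (AddCircle.liftIco (1 : ℝ) 0 f) = range p ∪ range b := by
    rw [← Path.trans_range]
    refine Subset.antisymm ?_ ?_
    · rintro _ ⟨s, rfl⟩
      obtain ⟨s, hs, rfl⟩ := AddCircle.eq_coe_Ico s
      rw [AddCircle.liftIco_zero_coe_apply hs, ← Path.extend_range]
      exact mem_range_self s
    · rintro _ ⟨s, rfl⟩
      rw [← Path.extend_extends']
      rcases s.2.2.eq_or_lt with h1 | h1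
      · exact ⟨(0 : ℝ), by rw [AddCircle.liftIco_zero_coe_apply (by simp), h1]; exact hf01⟩
      · exact ⟨(s : ℝ), AddCircle.liftIco_zero_coe_apply ⟨s.2.1, h1⟩⟩
  rw [← hrange]
  exact ⟨(hc.isClosedEmbedding hinj').isEmbedding.toHomeomorph.symm.trans
    (AddCircle.homeomorphCircle one_ne_zero)⟩

/-- An injective path between points of a path-connected closed set either stays in the set or
creates a simple closed curve together with it. -/
theorem exists_isSimpleClosedCurve_of_notMem {X : Type*} [TopologicalSpace X]
    [TopologicalSpace.MetrizableSpace X] {x y : X} (a : Path x y) (ha : Function.Injective a)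
    {L : Set X} (hL : IsClosed L) (hL' : IsPathConnected L) (hx : x ∈ L) (hy : y ∈ L)
    {t : unitInterval} (ht : a t ∉ L) :
    ∃ C, IsSimpleClosedCurve C ∧ a t ∈ C ∧ (C ∩ L).Nonempty := by
  have hcl : IsClosed (a ⁻¹' L) := hL.preimage a.continuous
  -- Between `s₀` and `s₁` the path makes an excursion off `L`; an arc in `L` joining its ends
  -- closes it up.
  obtain ⟨s₀, hs₀, hmax⟩ := (hcl.inter isClosed_Iic).isCompact.exists_isGreatest
    (⟨0, by simpa, t.2.1⟩ : (a ⁻¹' L ∩ Iic t).Nonempty)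
  obtain ⟨s₁, hs₁, hmin⟩ := (hcl.inter isClosed_Ici).isCompact.exists_isLeast
    (⟨1, by simpa, t.2.2⟩ : (a ⁻¹' L ∩ Ici t).Nonempty)
  have h₀ : s₀ < t := lt_of_le_of_ne hs₀.2 fun h => ht (h ▸ hs₀.1)
  have h₁ : t < s₁ := lt_of_le_of_ne hs₁.2 fun h => ht (h ▸ hs₁.1)
  have h01 := h₀.trans h₁
  obtain ⟨γ, hγ⟩ := hL'.joinedIn _ hs₁.1 _ hs₀.1
  obtain ⟨b, hb, hbγ⟩ := γ.exists_injective (ha.ne h01.ne')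
  have hbL : ∀ r, b r ∈ L := fun r => by
    obtain ⟨r', hr'⟩ := hbγ (mem_range_self r)
    exact hr' ▸ hγ r'
  have hrange := a.range_subpath_of_le s₀ s₁ h01.le
  refine ⟨_, isSimpleClosedCurve_range_union_range (a.subpath s₀ s₁) b ?_ hb ?_, ?_, ?_⟩
  · refine ha.comp fun r r' h => ?_
    have h' : ((Icc.convexComb s₀ s₁ r : unitInterval) : ℝ) = Icc.convexComb s₀ s₁ r' := by rw [h]
    have h01' : (s₀ : ℝ) < s₁ := h01
    simp only [Icc.coe_convexComb] at h'
    refine Subtype.ext (mul_left_cancel₀ (sub_pos.2 h01').ne' ?_)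
    linarith
  · intro r r' h
    obtain ⟨s, hs, hsr⟩ : a.subpath s₀ s₁ r ∈ a '' Icc s₀ s₁ := hrange ▸ mem_range_self r
    have hsL : a s ∈ L := by rw [hsr, h]; exact hbL r'
    rcases le_total s t with hst | hst
    · left
      rw [← hsr, hs.1.antisymm (hmax ⟨hsL, hst⟩)]
    · right
      rw [← hsr, hs.2.antisymm (hmin ⟨hsL, hst⟩)]
  · left
    rw [hrange]
    exact ⟨t, ⟨h₀.le, h₁.le⟩, rfl⟩
  · exact ⟨_, Or.inr ⟨0, rfl⟩, hbL 0⟩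

/-! ### Arcs in tree-graded spaces -/

namespace IsDisjointTreeGrading

variable {X : Type*} [TopologicalSpace X] {𝒢 : Set (Set X)}

theorem eq_pathComponentIn (hG : IsDisjointTreeGrading 𝒢) {P : Set X} (hP : P ∈ 𝒢) {x : X}
    (hx : x ∈ P) : P = pathComponentIn (⋃₀ 𝒢) x := by
  rw [hG.eq_pathComponents] at hP
  obtain ⟨y, -, rfl⟩ := hP
  exact (pathComponentIn_congr hx).symm

theorem isPathConnected (hG : IsDisjointTreeGrading 𝒢) {P : Set X} (hP : P ∈ 𝒢) :
    IsPathConnected P := by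
  obtain ⟨x, hx⟩ := hG.nonempty_of_mem P hP
  rw [hG.eq_pathComponentIn hP hx]
  exact isPathConnected_pathComponentIn ⟨P, hP, hx⟩

theorem eq_of_mem (hG : IsDisjointTreeGrading 𝒢) {P Q : Set X} (hP : P ∈ 𝒢) (hQ : Q ∈ 𝒢) {x : X}
    (hxP : x ∈ P) (hxQ : x ∈ Q) : P = Q :=
  (hG.eq_pathComponentIn hP hxP).trans (hG.eq_pathComponentIn hQ hxQ).symm

/-- An excursion off `P` would yield a simple closed curve meeting `P`. Its piece would have to be
`P`, as distinct pieces are disjoint. -/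
theorem range_subset_piece (hG : IsDisjointTreeGrading 𝒢) {P : Set X} (hP : P ∈ 𝒢) {x y : X}
    (hx : x ∈ P) (hy : y ∈ P) (a : Path x y) (ha : Function.Injective a) : range a ⊆ P := by
  have := hG.metrizable
  rintro _ ⟨t, rfl⟩
  by_contra ht
  obtain ⟨C, hC, htC, z, hzC, hzP⟩ := exists_isSimpleClosedCurve_of_notMem a ha
    (hG.isClosed_of_mem P hP) (hG.isPathConnected hP) hx hy ht
  obtain ⟨Q, hQ, hCQ⟩ := hG.simpleClosedCurve C hC
  exact ht (hG.eq_of_mem hQ hP (hCQ hzC) hzP ▸ hCQ htC)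

/-- A point of `a` missed by `γ` would lie on a simple closed curve, hence in a piece. -/
theorem range_subset_range (hG : IsDisjointTreeGrading 𝒢) {x y : X} (a : Path x y)
    (ha : Function.Injective a) (haG : Disjoint (range a) (⋃₀ 𝒢)) (γ : Path x y) :
    range a ⊆ range γ := by
  have := hG.metrizable
  rintro _ ⟨t, rfl⟩
  by_contra ht
  obtain ⟨C, hC, htC, -⟩ := exists_isSimpleClosedCurve_of_notMem a ha
    (isCompact_range γ.continuous).isClosed (isPathConnected_range γ.continuous)
    ⟨0, γ.source⟩ ⟨1, γ.target⟩ ht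
  obtain ⟨Q, hQ, hCQ⟩ := hG.simpleClosedCurve C hC
  exact disjoint_left.1 haG (mem_range_self t) ⟨Q, hQ, hCQ htC⟩

theorem isPathConnected_inter (hG : IsDisjointTreeGrading 𝒢) {P : Set X} (hP : P ∈ 𝒢) {V : Set X}
    (hV : IsPathConnected V) (hne : (V ∩ P).Nonempty) : IsPathConnected (V ∩ P) := by
  have := hG.metrizable
  refine isPathConnected_iff.2 ⟨hne, fun x hx y hy => ?_⟩
  rcases eq_or_ne x y with rfl | hxy
  · exact JoinedIn.refl hx
  obtain ⟨γ, hγ⟩ := hV.joinedIn x hx.1 y hy.1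
  obtain ⟨a, ha, haγ⟩ := γ.exists_injective hxy
  refine ⟨a, fun t => ⟨?_, hG.range_subset_piece hP hx.2 hy.2 a ha (mem_range_self t)⟩⟩
  obtain ⟨s, hs⟩ := haγ (mem_range_self t)
  exact hs ▸ hγ s

/-- Path-connected neighbourhoods in `X` stay path-connected when cut down to `P`, because arcs with
ends in `P` stay in `P`. This allows sections over `P` to be lifted to the coreflection. -/
theorem locallyPathConnectedSpace_piece (hG : IsDisjointTreeGrading 𝒢) {P : Set X} (hP : P ∈ 𝒢) :
    LocallyPathConnectedSpace P where
  path_connected_basis x := by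
    have := hG.locallyPathConnected
    rw [hasBasis_self]
    intro t ht
    obtain ⟨u, hu, hut⟩ := mem_nhds_subtype P x t |>.1 ht
    obtain ⟨V, ⟨hV, hVc⟩, hVu⟩ := (path_connected_basis (x : X)).mem_iff.1 hu
    refine ⟨Subtype.val ⁻¹' V, continuous_subtype_val.continuousAt.preimage_mem_nhds hV, ?_,
      (preimage_mono hVu).trans hut⟩
    rw [← Subtype.preimage_coe_inter_self]
    exact (hG.isPathConnected_inter hP hVc ⟨x, mem_of_mem_nhds hV, x.2⟩).preimage_coe
      inter_subset_right

end IsDisjointTreeGrading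

/-! ### Sections of the inverse limit over a piece -/

theorem MapsHomeomorphicallyOnto.exists_inverse {X Y : Type*} [TopologicalSpace X]
    [TopologicalSpace Y] {f : X → Y} {P : Set X} {Q : Set Y} (h : MapsHomeomorphicallyOnto f P Q) :
    ∃ g : Q → P, Continuous g ∧ ∀ y, f (g y) = y := by
  have hs : ∀ y : Q, ∃ x : P, f x = y := fun y => by
    obtain ⟨x, hx, hxy⟩ := h.2.symm.subset y.2
    exact ⟨⟨x, hx⟩, hxy⟩
  choose g hg using hs
  refine ⟨g, h.1.isInducing.continuous_iff.2 ?_, hg⟩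
  convert! continuous_subtype_val (p := fun y => y ∈ Q) using 1
  exact funext hg

namespace InverseLimit

variable {X : ℕ → Type*} {f : ∀ n, X (n + 1) → X n}

theorem apply_eq_of_le {x y : InverseLimit f} {n : ℕ} (h : x.1 n = y.1 n) {k : ℕ} (hk : k ≤ n) :
    x.1 k = y.1 k := by
  induction n, hk using Nat.le_induction with
  | base => exact h
  | succ n _ ih => exact ih (by rw [← x.2, ← y.2, h])

variable [∀ n, TopologicalSpace (X n)]

instance [∀ n, TopologicalSpace.MetrizableSpace (X n)] :
    TopologicalSpace.MetrizableSpace (InverseLimit f) := by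
  have : TopologicalSpace.MetrizableSpace (∀ n, X n) := by
    let := fun n => TopologicalSpace.metrizableSpaceMetric (X n)
    exact UniformSpace.metrizableSpace
  exact IsEmbedding.subtypeVal.metrizableSpace

/-- The compositions of the bonding maps, completed by constant maps. -/
theorem exists_bonding [∀ n, Nonempty (X n)] (hf : ∀ n, Continuous (f n)) (n : ℕ) :
    ∃ d : ∀ k, X n → X k, (∀ k, Continuous (d k)) ∧ d n = id ∧
      ∀ k < n, ∀ y, f k (d (k + 1) y) = d k y := by
  induction n with
  | zero =>
    refine ⟨fun k => if h : k = 0 then h ▸ id else fun _ => Classical.arbitrary _, fun k => ?_,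
      rfl, by simp⟩
    rcases k with _ | k
    · exact continuous_id
    · exact continuous_const
  | succ n ih =>
    obtain ⟨d, hd, hdn, hdk⟩ := ih
    refine ⟨Function.update (fun k => d k ∘ f n) (n + 1) id, fun k => ?_, by simp,
      fun k hk y => ?_⟩
    · rcases eq_or_ne k (n + 1) with rfl | hk
      · simpa using continuous_id
      · simpa [hk] using (hd k).comp (hf n)
    · rw [Function.update_of_ne hk.ne]
      rcases (Nat.lt_succ_iff.1 hk).eq_or_lt with rfl | hk'
      · simp [hdn]
      · rw [Function.update_of_ne (by omega)]
        exact hdk k hk' _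

/-- Below level `n` the coordinates are forced by the bonding maps; above it they come from
inverting the homeomorphisms between pieces. -/
theorem exists_section [∀ n, Nonempty (X n)] (hf : ∀ n, Continuous (f n)) {P : ∀ n, Set (X n)}
    {n : ℕ} (h : ∀ k ≥ n, MapsHomeomorphicallyOnto (f k) (P (k + 1)) (P k)) :
    ∃ σ : P n → InverseLimit f, Continuous σ ∧ (∀ y, (σ y).1 n = y) ∧
      ∀ k ≥ n, ∀ y, (σ y).1 k ∈ P k := by
  obtain ⟨d, hd, hdn, hdk⟩ := exists_bonding hf n
  -- Both conditions apply at `k = n`, where `d n = id` makes them compatible.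
  let T : ℕ → Type _ := fun k => {s : P n → X k // Continuous s ∧
    (k ≤ n → ∀ y : P n, s y = d k y) ∧ (n ≤ k → ∀ y, s y ∈ P k)}
  have step : ∀ k (s : T k), ∃ s' : T (k + 1), ∀ y, f k (s'.1 y) = s.1 y := by
    rintro k ⟨s, hs, hsd, hsP⟩
    rcases Nat.lt_or_ge k n with hk | hk
    · refine ⟨⟨fun y => d (k + 1) y, (hd _).comp continuous_subtype_val, fun _ _ => rfl, ?_⟩,
        fun y => ?_⟩
      · intro hnk y
        obtain rfl : n = k + 1 := by omega
        simp [hdn]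
      · rw [hdk k hk]
        exact (hsd hk.le y).symm
    · obtain ⟨g, hg, hfg⟩ := (h k hk).exists_inverse
      refine ⟨⟨fun y => g ⟨s y, hsP hk y⟩, by fun_prop, by omega, fun _ y => (g _).2⟩, fun y => ?_⟩
      exact hfg _
  choose step hstep using step
  let s : ∀ k, T k := fun k => Nat.rec ⟨fun y => d 0 y, (hd _).comp continuous_subtype_val,
    fun _ _ => rfl, fun hn y => by
      obtain rfl : n = 0 := Nat.le_zero.1 hn
      simp [hdn]⟩ (fun k s => step k s) k
  refine ⟨fun y => ⟨fun k => (s k).1 y, fun k => hstep k (s k) y⟩, ?_, fun y => ?_, fun k hk y => ?_⟩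
  · exact Continuous.subtype_mk (continuous_pi fun k => (s k).2.1) _
  · exact ((s n).2.2.1 le_rfl y).trans (by rw [hdn]; rfl)
  · exact (s k).2.2.2 hk y

end InverseLimit

/-! ### Pieces and closed curves in the limit -/

namespace LimitSpace

variable {X : ℕ → Type*} [∀ n, TopologicalSpace (X n)] {𝒢 : ∀ n, Set (Set (X n))}
  {f : ∀ n, X (n + 1) → X n} {x₀ : InverseLimit f}

theorem continuous_proj (n : ℕ) : Continuous (proj f x₀ n) :=
  (continuous_apply n).comp
    (continuous_subtype_val.comp (continuous_subtype_val.comp Lpc.continuous_toBase))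

theorem map_proj (n : ℕ) (x : LimitSpace f x₀) : f n (proj f x₀ (n + 1) x) = proj f x₀ n x :=
  x.toBase.1.2 n

theorem ext_proj {x y : LimitSpace f x₀} (h : ∀ n, proj f x₀ n x = proj f x₀ n y) : x = y :=
  Lpc.toBase_injective _ (Subtype.ext (Subtype.ext (funext h)))

theorem proj_ne_of_le {x y : LimitSpace f x₀} {m n : ℕ} (hmn : m ≤ n)
    (h : proj f x₀ m x ≠ proj f x₀ m y) : proj f x₀ n x ≠ proj f x₀ n y :=
  fun h' => h (InverseLimit.apply_eq_of_le h' hmn)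

/-- Distinct points are separated at some level and at all later ones, so increasing open sets cover
`K`. -/
theorem exists_proj_ne [∀ n, T2Space (X n)] {S : Type*} [TopologicalSpace S] {K : Set S}
    (hK : IsCompact K) {u v : S → LimitSpace f x₀} (hu : Continuous u) (hv : Continuous v)
    (h : ∀ t ∈ K, u t ≠ v t) : ∃ M, ∀ m ≥ M, ∀ t ∈ K, proj f x₀ m (u t) ≠ proj f x₀ m (v t) := by
  obtain ⟨M, hM⟩ := hK.elim_directed_cover (fun m => {t | proj f x₀ m (u t) ≠ proj f x₀ m (v t)})
    (fun m => isOpen_ne_fun ((continuous_proj m).comp hu) ((continuous_proj m).comp hv))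
    (fun t ht => by
      by_contra hn
      simp only [mem_iUnion, mem_ofPred_eq, not_exists, not_not] at hn
      exact h t ht (ext_proj hn))
    (Monotone.directed_le fun m n hmn t ht => proj_ne_of_le hmn ht)
  exact ⟨M, fun m hm t ht => proj_ne_of_le hm (hM ht)⟩

theorem mem_sUnion_of_le (hf : ∀ n, IsGradePreserving (𝒢 (n + 1)) (𝒢 n) (f n))
    {x : LimitSpace f x₀} {m n : ℕ} (hmn : m ≤ n) (h : proj f x₀ n x ∈ ⋃₀ 𝒢 n) :
    proj f x₀ m x ∈ ⋃₀ 𝒢 m := by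
  induction n, hmn using Nat.le_induction with
  | base => exact h
  | succ n _ ih => exact ih (map_proj n x ▸ (hf n).2 (mem_image_of_mem _ h))

theorem mem_sUnion_pieces (hG : ∀ n, IsDisjointTreeGrading (𝒢 n))
    (hf : ∀ n, IsGradePreserving (𝒢 (n + 1)) (𝒢 n) (f n)) {x : LimitSpace f x₀} :
    x ∈ ⋃₀ pieces 𝒢 f x₀ ↔ ∀ n, proj f x₀ n x ∈ ⋃₀ 𝒢 n := by
  constructor
  · rintro ⟨_, ⟨-, P, hP, rfl⟩, hx⟩ n
    exact ⟨P n, hP.1 n, hx n⟩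
  · intro h
    have hx : ∀ n, proj f x₀ n x ∈ pathComponentIn (⋃₀ 𝒢 n) (proj f x₀ n x) :=
      fun n => mem_pathComponentIn_self (h n)
    -- The path components of the coordinates are pieces, and they are coherent because a
    -- path-connected image stays in one component.
    refine ⟨{y | ∀ n, proj f x₀ n y ∈ pathComponentIn (⋃₀ 𝒢 n) (proj f x₀ n x)},
      ⟨⟨x, hx⟩, _, ⟨fun n => ?_, fun n => ?_⟩, rfl⟩, hx⟩
    · exact (hG n).eq_pathComponents.symm.subset ⟨_, h n, rfl⟩
    · refine ((isPathConnected_pathComponentIn (h (n + 1))).image (hf n).1).subset_pathComponentIn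
        ⟨_, hx (n + 1), map_proj n x⟩ ?_
      exact (image_mono pathComponentIn_subset).trans (hf n).2

/-- A piece of the limit space is a copy of a piece of all but finitely many terms. -/
theorem exists_parametrization (hG : ∀ n, IsDisjointTreeGrading (𝒢 n))
    (hf : ∀ n, IsGradePreserving (𝒢 (n + 1)) (𝒢 n) (f n)) {P : ∀ n, Set (X n)}
    (hP : IsCoherent 𝒢 f P) {n : ℕ}
    (hn : ∀ k ≥ n, MapsHomeomorphicallyOnto (f k) (P (k + 1)) (P k))
    (hne : {x | ∀ n, proj f x₀ n x ∈ P n}.Nonempty) :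
    ∃ τ : P n → LimitSpace f x₀, Continuous τ ∧ (∀ y, proj f x₀ n (τ y) = y) ∧
      range τ = {x | ∀ n, proj f x₀ n x ∈ P n} := by
  have : ∀ n, PathConnectedSpace (X n) := fun n => (hG n).pathConnected
  have := (hG n).locallyPathConnectedSpace_piece (hP.1 n)
  have := isPathConnected_iff_pathConnectedSpace.1 ((hG n).isPathConnected (hP.1 n))
  obtain ⟨σ, hσ, hσn, hσP⟩ := InverseLimit.exists_section (fun n => (hf n).1) hn
  have hσP' : ∀ k y, (σ y).1 k ∈ P k := by
    intro k y
    rcases le_total n k with hk | hk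
    · exact hσP k hk y
    induction hk using Nat.decreasingInduction with
    | of_succ k _ ih => exact (σ y).2 k ▸ hP.2 k (mem_image_of_mem _ ih)
    | self => exact hσP n le_rfl y
  have hσx : ∀ x : InverseLimit f, (hx : ∀ k, x.1 k ∈ P k) → σ ⟨x.1 n, hx n⟩ = x := by
    refine fun x hx => Subtype.ext (funext fun k => ?_)
    rcases le_total k n with hk | hk
    · exact InverseLimit.apply_eq_of_le (hσn _) hk
    · induction k, hk using Nat.le_induction with
      | base => exact hσn _
      | succ k hk ih =>
        refine congrArg Subtype.val ((hn k hk).1.injective (a₁ := ⟨_, hσP' (k + 1) _⟩)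
          (a₂ := ⟨_, hx (k + 1)⟩) ?_)
        exact ((σ _).2 k).trans (ih.trans (x.2 k).symm)
  obtain ⟨z, hz⟩ := hne
  -- The piece meets `X_lim` at `z`, and `P n` is path-connected, so the whole section lies in that
  -- path component.
  have hjoin : ∀ y, σ y ∈ pathComponent x₀ := fun y => by
    refine Joined.trans z.toBase.2 ?_
    rw [← hσx z.toBase.1 hz]
    exact (PathConnectedSpace.joined _ y).map hσ
  refine ⟨fun y => ⟨⟨σ y, hjoin y⟩⟩, Lpc.continuous_of_toBase (hσ.subtype_mk _), hσn, ?_⟩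
  refine Subset.antisymm ?_ fun x hx => ⟨⟨_, hx n⟩, ?_⟩
  · rintro _ ⟨y, rfl⟩ k
    exact hσP' k y
  · exact Lpc.toBase_injective _ (Subtype.ext (hσx x.toBase.1 hx))

theorem mapsHomeomorphicallyOnto_of_parametrization {n : ℕ} {P : Set (X n)}
    {τ : P → LimitSpace f x₀} (hτ : Continuous τ) (hτn : ∀ y, proj f x₀ n (τ y) = y) :
    MapsHomeomorphicallyOnto (proj f x₀ n) (range τ) P := by
  have hmem : ∀ x : range τ, proj f x₀ n x ∈ P := by
    rintro ⟨_, y, rfl⟩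
    rw [hτn]
    exact y.2
  constructor
  · have h : IsEmbedding fun x : range τ => (⟨proj f x₀ n x, hmem x⟩ : P) := by
      refine .of_leftInverse (f := rangeFactorization τ) ?_ hτ.rangeFactorization
        (((continuous_proj n).comp continuous_subtype_val).subtype_mk _)
      rintro ⟨_, y, rfl⟩
      exact Subtype.ext (congrArg τ (Subtype.ext (hτn y)))
    exact IsEmbedding.subtypeVal.comp h
  · refine Subset.antisymm (image_subset_iff.2 fun x hx => hmem ⟨x, hx⟩) fun y hy => ?_
    exact ⟨_, mem_range_self ⟨y, hy⟩, hτn _⟩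

theorem isPathConnected_of_mem_pieces (hG : ∀ n, IsDisjointTreeGrading (𝒢 n))
    (hf : ∀ n, IsGradePreserving (𝒢 (n + 1)) (𝒢 n) (f n))
    (hcoh : ∀ P : ∀ n, Set (X n), IsCoherent 𝒢 f P →
      ∀ᶠ n in atTop, MapsHomeomorphicallyOnto (f n) (P (n + 1)) (P n))
    {Q : Set (LimitSpace f x₀)} (hQ : Q ∈ pieces 𝒢 f x₀) : IsPathConnected Q := by
  obtain ⟨hne, P, hP, rfl⟩ := hQ
  obtain ⟨N, hN⟩ := eventually_atTop.1 (hcoh P hP)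
  obtain ⟨τ, hτ, -, hr⟩ := exists_parametrization hG hf hP hN hne
  have := isPathConnected_iff_pathConnectedSpace.1 ((hG N).isPathConnected (hP.1 N))
  rw [← hr]
  exact isPathConnected_range hτ

/-- A path in the union of limit pieces projects into the piece-portion of each level, so it cannot
leave `P n`. -/
theorem eq_pathComponentIn_of_mem_pieces (hG : ∀ n, IsDisjointTreeGrading (𝒢 n))
    (hf : ∀ n, IsGradePreserving (𝒢 (n + 1)) (𝒢 n) (f n))
    (hcoh : ∀ P : ∀ n, Set (X n), IsCoherent 𝒢 f P →
      ∀ᶠ n in atTop, MapsHomeomorphicallyOnto (f n) (P (n + 1)) (P n))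
    {Q : Set (LimitSpace f x₀)} (hQ : Q ∈ pieces 𝒢 f x₀) {x : LimitSpace f x₀} (hx : x ∈ Q) :
    Q = pathComponentIn (⋃₀ pieces 𝒢 f x₀) x := by
  refine Subset.antisymm ((isPathConnected_of_mem_pieces hG hf hcoh hQ).subset_pathComponentIn hx
    (subset_sUnion_of_mem hQ)) fun y hy => ?_
  obtain ⟨-, P, hP, rfl⟩ := hQ
  intro n
  rw [(hG n).eq_pathComponentIn (hP.1 n) (hx n)]
  refine (JoinedIn.map hy (continuous_proj n)).mono ?_
  rintro _ ⟨z, hz, rfl⟩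
  exact (mem_sUnion_pieces hG hf).1 hz n

/-- At a late level, an arc inside the projection of `[0, b]` must also lie in that of `[b, 1]`.
Separating suitable thirds of `[0, b]` by compactness makes this impossible. -/
theorem not_injOn_of_notMem (hG : ∀ n, IsDisjointTreeGrading (𝒢 n))
    (hf : ∀ n, IsGradePreserving (𝒢 (n + 1)) (𝒢 n) (f n)) {c : ℝ → LimitSpace f x₀}
    (hc : Continuous c) (hc01 : c 0 = c 1) {n : ℕ} (hn : proj f x₀ n (c 0) ∉ ⋃₀ 𝒢 n) :
    ¬ InjOn c (Ico 0 1) := by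
  intro hinj
  have := fun n => (hG n).metrizable
  have hpc : ∀ m, Continuous fun t => proj f x₀ m (c t) := fun m => (continuous_proj m).comp hc
  obtain ⟨b, hb0, hb1, hb⟩ : ∃ b > 0, b < 1 ∧ ∀ t ∈ Icc 0 b, proj f x₀ n (c t) ∉ ⋃₀ 𝒢 n := by
    obtain ⟨δ, hδ, h⟩ := Metric.isOpen_iff.1 ((hG n).isClosed_sUnion.preimage (hpc n)).isOpen_compl
      0 hn
    refine ⟨min (δ / 2) (1 / 2), by positivity, by linarith [min_le_right (δ / 2) (1 / 2)], fun t ht => h ?_⟩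
    rw [Metric.mem_ball, Real.dist_eq, sub_zero, abs_of_nonneg ht.1]
    linarith [ht.2, min_le_left (δ / 2) (1 / 2)]
  -- The middle third is kept off the rest of the loop, and below the two outer thirds are kept off
  -- each other; both pairs are disjoint compact sets upstairs.
  obtain ⟨M₁, hM₁⟩ := exists_proj_ne (K := Icc (b / 3) (2 * b / 3) ×ˢ Icc b 1)
    (isCompact_Icc.prod isCompact_Icc) (hc.comp continuous_fst) (hc.comp continuous_snd) (by
      rintro ⟨s, t⟩ ⟨hs, ht⟩ hst
      simp only [mem_Icc, Function.comp_apply] at hs ht hst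
      rcases ht.2.eq_or_lt with rfl | ht1
      · rw [← hc01] at hst
        have := hinj ⟨by linarith, by linarith⟩ ⟨le_rfl, one_pos⟩ hst
        linarith
      · have := hinj ⟨by linarith, by linarith⟩ ⟨by linarith, ht1⟩ hst
        linarith)
  obtain ⟨M₂, hM₂⟩ := exists_proj_ne (K := Icc 0 (b / 3) ×ˢ Icc (2 * b / 3) b)
    (isCompact_Icc.prod isCompact_Icc) (hc.comp continuous_fst) (hc.comp continuous_snd) (by
      rintro ⟨s, t⟩ ⟨hs, ht⟩ hst
      simp only [mem_Icc, Function.comp_apply] at hs ht hst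
      have := hinj ⟨by linarith, by linarith⟩ ⟨by linarith, by linarith⟩ hst
      linarith)
  obtain ⟨m, hnm, hm₁, hm₂⟩ : ∃ m, n ≤ m ∧ M₁ ≤ m ∧ M₂ ≤ m :=
    ⟨max n (max M₁ M₂), by simp, by simp, by simp⟩
  set p : ℝ → X m := fun t => proj f x₀ m (c t) with hp
  have hpm : Continuous p := hpc m
  have hp₁ : ∀ s ∈ Icc (b / 3) (2 * b / 3), ∀ t ∈ Icc b 1, p s ≠ p t :=
    fun s hs t ht => hM₁ m hm₁ (s, t) ⟨hs, ht⟩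
  have hp₂ : ∀ s ∈ Icc 0 (b / 3), ∀ t ∈ Icc (2 * b / 3) b, p s ≠ p t :=
    fun s hs t ht => hM₂ m hm₂ (s, t) ⟨hs, ht⟩
  let K : Path (p 0) (p b) :=
    ⟨⟨fun t => p (b * t), by fun_prop⟩, by simp, by simp⟩
  -- The rest of the loop, traversed backwards from `p 1 = p 0`.
  let L : Path (p 0) (p b) :=
    ⟨⟨fun t => p (1 - (1 - b) * t), by fun_prop⟩, by simp [hp, hc01], by simp⟩
  obtain ⟨a, ha, haK⟩ := K.exists_injective
    (hp₂ 0 ⟨le_rfl, by positivity⟩ b ⟨by linarith, le_rfl⟩)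
  have haK' : ∀ z ∈ range a, ∃ s ∈ Icc 0 b, p s = z := by
    intro z hz
    obtain ⟨t, rfl⟩ := haK hz
    refine ⟨b * t, ⟨mul_nonneg hb0.le t.2.1, ?_⟩, rfl⟩
    nlinarith [t.2.2]
  have haL : range a ⊆ range L := by
    refine (hG m).range_subset_range a ha (disjoint_left.2 fun z hz hzG => ?_) L
    obtain ⟨s, hs, rfl⟩ := haK' z hz
    exact hb s hs (mem_sUnion_of_le hf hnm hzG)
  -- Since the arc also lies in the image of `[b, 1]`, it cannot meet the middle third.
  have hsplit : range a ⊆ p '' Icc 0 (b / 3) ∪ p '' Icc (2 * b / 3) b := by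
    intro z hz
    obtain ⟨s, hs, rfl⟩ := haK' z hz
    obtain ⟨t, ht⟩ := haL hz
    by_contra hcon
    refine hp₁ s ⟨?_, ?_⟩ (1 - (1 - b) * t) ⟨?_, ?_⟩ ht.symm
    · by_contra h
      exact hcon (Or.inl ⟨s, ⟨hs.1, by linarith⟩, rfl⟩)
    · by_contra h
      exact hcon (Or.inr ⟨s, ⟨by linarith, hs.2⟩, rfl⟩)
    · nlinarith [t.2.2]
    · nlinarith [t.2.1]
  -- The connected arc starts in one outer third and ends in the other, so the two closed images
  -- intersect.
  obtain ⟨z, -, ⟨s, hs, hsz⟩, t, ht, htz⟩ := isPreconnected_closed_iff.1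
    (isPreconnected_range a.continuous) _ _ (isCompact_Icc.image hpm).isClosed
    (isCompact_Icc.image hpm).isClosed hsplit
    ⟨p 0, ⟨0, a.source⟩, 0, ⟨le_rfl, by positivity⟩, rfl⟩
    ⟨p b, ⟨1, a.target⟩, b, ⟨by linarith, le_rfl⟩, rfl⟩
  exact hp₂ s hs t ht (hsz.trans htz.symm)

end LimitSpace

/-! ### Parametrized circles and the main theorem -/

theorem IsSimpleClosedCurve.exists_loop {X : Type*} [TopologicalSpace X] {C : Set X}
    (hC : IsSimpleClosedCurve C) {x : X} (hx : x ∈ C) :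
    ∃ c : ℝ → X, Continuous c ∧ c 0 = x ∧ c 0 = c 1 ∧ InjOn c (Ico 0 1) := by
  obtain ⟨e⟩ := hC
  refine ⟨fun t => e.symm (e ⟨x, hx⟩ * Circle.exp (2 * Real.pi * t)), ?_, ?_, ?_, ?_⟩
  · have := Circle.exp.continuous
    fun_prop
  · simp
  · simp
  · intro s hs t ht h
    have h' := mul_left_cancel (e.symm.injective (Subtype.ext h))
    obtain ⟨m, hm⟩ := Circle.exp_eq_exp.1 h'
    have hst : s = t + m := by
      have := Real.pi_pos
      field_simp at hm
      linarith
    have h1 : (m : ℝ) < 1 := by linarith [hs.2, ht.1]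
    have h2 : (-1 : ℝ) < m := by linarith [hs.1, ht.2]
    have : m = 0 := by
      have h1' : m < 1 := by exact_mod_cast h1
      have h2' : -1 < m := by exact_mod_cast h2
      omega
    simpa [this] using hst

theorem IsSimpleClosedCurve.isPathConnected {X : Type*} [TopologicalSpace X] {C : Set X}
    (hC : IsSimpleClosedCurve C) : IsPathConnected C := by
  obtain ⟨e⟩ := hC
  have : PathConnectedSpace Circle :=
    (Circle.exp_surjective).pathConnectedSpace Circle.exp.continuous
  rw [isPathConnected_iff_pathConnectedSpace]
  exact e.symm.surjective.pathConnectedSpace e.symm.continuous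

theorem mainTheorem10 {X : ℕ → Type*} [∀ n, TopologicalSpace (X n)]
    (𝒢 : ∀ n, Set (Set (X n))) (hG : ∀ n, IsDisjointTreeGrading (𝒢 n))
    (f : ∀ n, X (n + 1) → X n) (hf : ∀ n, IsGradePreserving (𝒢 (n + 1)) (𝒢 n) (f n))
    (hcoh : ∀ P : ∀ n, Set (X n), IsCoherent 𝒢 f P →
      ∀ᶠ n in atTop, MapsHomeomorphicallyOnto (f n) (P (n + 1)) (P n))
    (x₀ : InverseLimit f) :
    IsDisjointTreeGrading (LimitSpace.pieces 𝒢 f x₀) ∧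
    (∀ n, IsGradePreserving (LimitSpace.pieces 𝒢 f x₀) (𝒢 n) (LimitSpace.proj f x₀ n)) ∧
    ∀ Q ∈ LimitSpace.pieces 𝒢 f x₀, ∀ᶠ n in atTop,
      ∃ P ∈ 𝒢 n, MapsHomeomorphicallyOnto (LimitSpace.proj f x₀ n) Q P := by
  have := fun n => (hG n).metrizable
  have : PathConnectedSpace (pathComponent x₀) :=
    isPathConnected_iff_pathConnectedSpace.1 isPathConnected_pathComponent
  have hmem := @LimitSpace.mem_sUnion_pieces X _ 𝒢 f x₀ hG hf
  have hcomp := @LimitSpace.eq_pathComponentIn_of_mem_pieces X _ 𝒢 f x₀ hG hf hcoh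
  refine ⟨⟨inferInstance, inferInstance, inferInstance, fun Q hQ => hQ.1, ?_, ?_, ?_, ?_⟩,
    fun n => ⟨LimitSpace.continuous_proj n, ?_⟩, ?_⟩
  · rintro _ ⟨-, P, hP, rfl⟩
    rw [ofPred_forall]
    exact isClosed_iInter fun n =>
      ((hG n).isClosed_of_mem _ (hP.1 n)).preimage (LimitSpace.continuous_proj n)
  · rw [show ⋃₀ LimitSpace.pieces 𝒢 f x₀ = ⋂ n, LimitSpace.proj f x₀ n ⁻¹' ⋃₀ 𝒢 n by
      ext x; simpa only [mem_iInter, mem_preimage] using hmem]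
    exact isClosed_iInter fun n => (hG n).isClosed_sUnion.preimage (LimitSpace.continuous_proj n)
  · ext Q
    constructor
    · intro hQ
      obtain ⟨x, hx⟩ := hQ.1
      exact ⟨x, ⟨Q, hQ, hx⟩, hcomp hQ hx⟩
    · rintro ⟨x, ⟨Q', hQ', hx⟩, rfl⟩
      rwa [← hcomp hQ' hx]
  · intro C hC
    have hCsub : C ⊆ ⋃₀ LimitSpace.pieces 𝒢 f x₀ := by
      refine fun x hx => hmem.2 fun n => ?_
      by_contra hn
      -- The curve is parametrized from the offending point, so that the bad parameter is `0`.
      obtain ⟨c, hc, rfl, hc01, hinj⟩ := hC.exists_loop hx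
      exact LimitSpace.not_injOn_of_notMem hG hf hc hc01 hn hinj
    obtain ⟨x, hx⟩ := hC.isPathConnected.nonempty
    obtain ⟨Q, hQ, hxQ⟩ := hCsub hx
    refine ⟨Q, hQ, ?_⟩
    rw [hcomp hQ hxQ]
    exact hC.isPathConnected.subset_pathComponentIn hx hCsub
  · rintro _ ⟨x, hx, rfl⟩
    exact hmem.1 hx n
  · rintro _ ⟨hne, P, hP, rfl⟩
    obtain ⟨N, hN⟩ := eventually_atTop.1 (hcoh P hP)
    filter_upwards [eventually_ge_atTop N] with n hn
    obtain ⟨τ, hτ, hτn, hr⟩ :=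
      LimitSpace.exists_parametrization hG hf hP (fun k hk => hN k (hn.trans hk)) hne
    refine ⟨P n, hP.1 n, ?_⟩
    rw [← hr]
    exact LimitSpace.mapsHomeomorphicallyOnto_of_parametrization hτ hτn
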